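/- Let $\alpha$ be an irrational real number with continued fraction expansion $\alpha=[a_0;a_1,a_2,\ldots]$, and let $q_0=1$, $q_1=a_1$, $q_l=a_lq_{l-1}+q_{l-2}$ $(l\ge 2)$ be the denominators of its convergents (the best approximation denominators of $\alpha$). For all integers $l\ge 0$ and $N$ with $q_l\le N<q_{l+1}$ we have $$\frac1N\sum_{n=1}^N\log|2\sin(\pi n\alpha)|\;\le\;(\log 2)\left(\frac1{q_l}+\frac{l}{2^{(l-3)/2}}\right)+3\,\frac{\log q_l}{q_l}\left(\frac{\log q_l}{\log\phi}+1\right),$$ where $\phi=(1+\sqrt5)/2$; the right-hand side tends to $0$ as $l\to\infty$. Hence $$\limsup_{N\to\infty}\frac1N\sum_{n=1}^N\log|2\sin(\pi n\alpha)|=0=\int_0^1\log(2\sin(\pi x))\,dx,$$ where the function $x\mapsto\log(2\sin(\pi x))$ is integrable on $[0,1]$. -/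

import Mathlib

/-- The Cesàro mean `(1/N) ∑_{n=1}^N log |2 sin (π n α)|`. -/
noncomputable def kroneckerLogMean (α : ℝ) (N : ℕ) : ℝ :=
  (1 / (N : ℝ)) * ∑ n ∈ Finset.Icc 1 N, Real.log |2 * Real.sin (Real.pi * (n : ℝ) * α)|

/-- The denominator `q_l` of the `l`-th convergent of the regular continued fraction
`[a_0; a_1, a_2, …]` of `α`: `q_0 = 1`, `q_1 = a_1`, `q_l = a_l q_{l-1} + q_{l-2}`. -/
noncomputable def bestDen (α : ℝ) (l : ℕ) : ℝ :=
  (GenContFract.of α).dens l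

/-- The upper bound, an explicit function of `q_l` and `l`. -/
noncomputable def kroneckerBound (α : ℝ) (l : ℕ) : ℝ :=
  Real.log 2 * (1 / bestDen α l + (l : ℝ) / (2 : ℝ) ^ (((l : ℝ) - 3) / 2)) +
    3 * (Real.log (bestDen α l) / bestDen α l) *
      (Real.log (bestDen α l) / Real.log ((1 + Real.sqrt 5) / 2) + 1)

/-! Write |2 sin(πnα)| as the chord |1 - e^{2πinα}|, so that the mean is the logarithm of a chord
product divided by N. Everything is compared with roots of unity: ∏_{k=1}^{q-1} |1 - e^{2πik/q}| =
q, and rotating all these points by one common angle gives at most q.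

If p/q is a convergent, each of q successive points x + nα lies in its own cell of length 1/q,
because the drift away from a rotated lattice is at most 1/q. The chord is monotone on either side
of 1/2, so moving each point to the better endpoint of its cell compares the product with a lattice
product. This gives the upper bound 2q for a block of q factors (`prod_chord_block_le`) and the
lower bound 2/q for the first q - 1 factors (`le_prod_chord`).

For the upper bound on the mean, N is split greedily into blocks whose lengths are denominators q_j.
A block costs log(2q_j), that is log(2q_j)/q_j per index, and these costs decrease in j. Hence the
logarithm of the product is at most ∑_{j<l} (q_{j+1} - q_j) log(2q_j)/q_j + N log(2q_l)/q_l
(`prod_chord_le_exp`). Since q_j F_{k+1} ≤ q_{j+k}, Abel summation reduces the sum to a Fibonacci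
estimate (`sum_den_le`), used for l ≥ 10; for smaller l the stated bound is already at least log 2,
a trivial bound for the mean.

The bound tends to 0, so the limsup is at most 0. Along N = q_l - 1 the mean is at least -2
log(q_l)/q_l, which tends to 0, so the limsup is at least 0. -/

/-! ### Chords of the unit circle -/

/-- The length `|1 - e^{2πit}| = |2 sin (π t)|` of a chord of the unit circle. -/
noncomputable def chord (t : ℝ) : ℝ := |2 * Real.sin (Real.pi * t)|

lemma chord_nonneg (t : ℝ) : 0 ≤ chord t := abs_nonneg _

lemma chord_le_two (t : ℝ) : chord t ≤ 2 := by
  rw [chord, abs_mul, abs_two]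
  linarith [Real.abs_sin_le_one (Real.pi * t)]

lemma chord_neg (t : ℝ) : chord (-t) = chord t := by
  rw [chord, chord, mul_neg, Real.sin_neg, mul_neg, abs_neg]

lemma chord_add_int (t : ℝ) (m : ℤ) : chord (t + m) = chord t := by
  rw [chord, chord, mul_add, mul_comm Real.pi (m : ℝ), Real.sin_add_int_mul_pi, abs_mul, abs_mul,
    abs_mul, abs_zpow, abs_neg, abs_one, one_zpow, one_mul]

lemma chord_one_sub (t : ℝ) : chord (1 - t) = chord t := by
  have := chord_add_int (-t) 1
  rw [chord_neg] at this
  rw [← this]; push_cast; ring_nf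

lemma chord_eq_of_mem {t : ℝ} (h0 : 0 ≤ t) (h1 : t ≤ 1) :
    chord t = 2 * Real.sin (Real.pi * t) := by
  have : 0 ≤ Real.sin (Real.pi * t) := by
    apply Real.sin_nonneg_of_nonneg_of_le_pi <;> nlinarith [Real.pi_pos]
  rw [chord, abs_of_nonneg (by linarith)]

/-- The chord is symmetric about 1/2 and increases up to it; s ≤ t and s + t ≤ 1 say exactly that t
is to the right of s and no farther from 1/2. -/
lemma chord_le_chord {s t : ℝ} (h0 : 0 ≤ s) (hst : s ≤ t) (h1 : s + t ≤ 1) :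
    chord s ≤ chord t := by
  rw [chord_eq_of_mem h0 (by linarith), chord_eq_of_mem (by linarith) (by linarith)]
  have hp := Real.pi_pos
  have key : Real.sin (Real.pi * s) ≤ Real.sin (Real.pi * t) := by
    rcases le_total t (1 / 2) with ht | ht
    · apply Real.sin_le_sin_of_le_of_le_pi_div_two <;> nlinarith
    · rw [← Real.sin_pi_sub (Real.pi * t)]
      apply Real.sin_le_sin_of_le_of_le_pi_div_two <;> nlinarith
  linarith

lemma chord_le_chord' {s t : ℝ} (hst : s ≤ t) (ht : t ≤ 1) (h1 : 1 ≤ s + t) :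
    chord t ≤ chord s := by
  rw [← chord_one_sub t, ← chord_one_sub s]
  exact chord_le_chord (by linarith) (by linarith) (by linarith)

lemma min_chord_le {a y b : ℝ} (ha : 0 ≤ a) (hay : a ≤ y) (hyb : y ≤ b) (hb : b ≤ 1) :
    min (chord a) (chord b) ≤ chord y := by
  rcases le_total (a + y) 1 with h | h
  · exact (min_le_left _ _).trans (chord_le_chord ha hay h)
  · exact (min_le_right _ _).trans (chord_le_chord' hyb hb (by linarith))

lemma four_mul_le_chord {t : ℝ} (h0 : 0 ≤ t) (h1 : t ≤ 1 / 2) : 4 * t ≤ chord t := by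
  rw [chord_eq_of_mem h0 (by linarith)]
  have hp := Real.pi_pos
  have := Real.mul_le_sin (x := Real.pi * t) (by positivity) (by nlinarith)
  have e : 2 / Real.pi * (Real.pi * t) = 2 * t := by field_simp
  linarith

lemma norm_exp_sub_one_eq_chord (t : ℝ) :
    ‖Complex.exp (2 * Real.pi * Complex.I * t) - 1‖ = chord t := by
  have := Complex.norm_exp_I_mul_ofReal_sub_one (2 * Real.pi * t)
  rw [show Complex.I * ((2 * Real.pi * t : ℝ) : ℂ) = 2 * Real.pi * Complex.I * t by
    push_cast; ring] at this
  rw [this, chord, Real.norm_eq_abs]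
  ring_nf

/-! ### Chord products over rotated roots of unity -/

lemma prod_sub_pow_eq_geom_sum {n : ℕ} {μ : ℂ} (hμ : IsPrimitiveRoot μ (n + 1)) (z : ℂ) :
    ∏ k ∈ Finset.range n, (z - μ ^ (k + 1)) = ∑ k ∈ Finset.range (n + 1), z ^ k := by
  have := X_pow_sub_C_eq_prod hμ n.zero_lt_succ (one_pow (n + 1))
  rw [Polynomial.C_1, ← mul_geom_sum, Finset.prod_range_succ', pow_zero, mul_one, mul_comm,
    eq_comm] at this
  replace this := mul_right_cancel₀ (Polynomial.X_sub_C_ne_zero 1) this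
  apply_fun Polynomial.eval z at this
  simpa [Polynomial.eval_prod, Polynomial.eval_geom_sum] using this

lemma norm_exp_neg_two_pi_mul (t : ℝ) :
    ‖Complex.exp (-(2 * Real.pi * Complex.I * (t : ℂ)))‖ = 1 := by
  have := Complex.norm_exp_ofReal_mul_I (-(2 * Real.pi * t))
  rwa [show ((-(2 * Real.pi * t) : ℝ) : ℂ) * Complex.I = -(2 * Real.pi * Complex.I * (t : ℂ)) by
    push_cast; ring] at this

/-- Evaluate the factorisation of 1 + z + ⋯ + z^n over the nontrivial (n+1)-th roots of unity at z =
e^{-2πit/(n+1)}. The triangle inequality then bounds the product by n + 1, with equality at t = 0.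
-/
lemma prod_chord_eq_norm (n : ℕ) (t : ℝ) :
    ∏ k ∈ Finset.range n, chord ((k + 1 + t) / (n + 1)) =
      ‖∑ k ∈ Finset.range (n + 1),
        Complex.exp (-(2 * Real.pi * Complex.I * ((t / (n + 1) : ℝ) : ℂ))) ^ k‖ := by
  have hμ := Complex.isPrimitiveRoot_exp (n + 1) n.succ_ne_zero
  rw [← prod_sub_pow_eq_geom_sum hμ, norm_prod]
  refine Finset.prod_congr rfl fun k _ => ?_
  rw [← norm_exp_sub_one_eq_chord]
  set w := Complex.exp (-(2 * Real.pi * Complex.I * ((t / (n + 1) : ℝ) : ℂ))) with hw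
  have hw1 : ‖w‖ = 1 := norm_exp_neg_two_pi_mul _
  have e : Complex.exp (2 * Real.pi * Complex.I / ((n + 1 : ℕ) : ℂ)) ^ (k + 1)
      = w * Complex.exp (2 * Real.pi * Complex.I * (((k + 1 + t) / (n + 1) : ℝ) : ℂ)) := by
    rw [hw, ← Complex.exp_nat_mul, ← Complex.exp_add]
    congr 1
    have : ((n : ℂ) + 1) ≠ 0 := by exact_mod_cast n.succ_ne_zero
    push_cast
    field_simp
    ring
  rw [e, show ∀ x : ℂ, w - w * x = -(w * (x - 1)) by intro x; ring, norm_neg, norm_mul, hw1,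
    one_mul]

lemma prod_chord_le (n : ℕ) (t : ℝ) :
    ∏ k ∈ Finset.range n, chord ((k + 1 + t) / (n + 1)) ≤ n + 1 := by
  rw [prod_chord_eq_norm]
  refine (norm_sum_le _ _).trans ?_
  refine (Finset.sum_le_sum (g := fun _ => (1 : ℝ)) fun k _ => ?_).trans (by simp)
  rw [norm_pow, norm_exp_neg_two_pi_mul, one_pow]

lemma prod_chord_eq (n : ℕ) :
    ∏ k ∈ Finset.range n, chord ((k + 1 : ℝ) / (n + 1)) = n + 1 := by
  have := prod_chord_eq_norm n 0
  simp only [add_zero] at this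
  rw [this]
  simp
  exact_mod_cast Complex.norm_natCast (n + 1)

/-! ### Upper bound for a block of q factors -/

/-- `M k` bounds the chord on the cell from (k+θ)/Q to (k+θ+1)/Q: the right endpoint value before
1/2, the trivial 2 on cell m, which contains 1/2 by the two hypotheses on m, and the left endpoint
value after it. The last cell may cross 1, so it takes the larger of its two endpoint values. Apart
from the factor 2, what remains is a product over Q - 1 consecutive points of a rotated lattice,
hence at most Q. -/
lemma exists_cell_majorant {m r : ℕ} {θ : ℝ} (h0 : 0 ≤ θ) (h1 : θ ≤ 1)
    (hm : 2 * (m + θ) ≤ (m + r + 2 : ℕ)) (hm' : ((m + r + 2 : ℕ) : ℝ) ≤ 2 * (m + 1 + θ)) :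
    ∃ M : ℕ → ℝ, (∀ k < m + r + 2, ∀ e : ℝ, 0 ≤ e → e ≤ 1 →
        chord ((k + θ + e) / (m + r + 2 : ℕ)) ≤ M k) ∧
      ∏ k ∈ Finset.range (m + r + 2), M k ≤ 2 * (m + r + 2 : ℕ) := by
  set Q : ℝ := ((m + r + 2 : ℕ) : ℝ) with hQ
  have hQ' : Q = m + r + 2 := by rw [hQ]; push_cast; ring
  have hm0 : (0 : ℝ) ≤ m := Nat.cast_nonneg _
  have hr0 : (0 : ℝ) ≤ r := Nat.cast_nonneg _
  have hQ0 : 0 < Q := by linarith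
  set c : ℕ → ℝ := fun k => chord ((k + θ) / Q) with hc
  have c_nonneg : ∀ k, 0 ≤ c k := fun k => chord_nonneg _
  set M : ℕ → ℝ := fun k => if k < m then c (k + 1) else if k = m then 2 else
    if k < m + r + 1 then c k else max (c k) (c 0) with hM
  refine ⟨M, fun k hk e he0 he1 => ?_, ?_⟩
  · have hk0 : (0 : ℝ) ≤ k := Nat.cast_nonneg _
    simp only [hM, hc]
    split_ifs with ha hb hd
    · have : (k : ℝ) + 1 ≤ m := by exact_mod_cast ha
      apply chord_le_chord
      · positivity
      · exact div_le_div_of_nonneg_right (by push_cast; linarith) hQ0.le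
      · rw [← add_div, div_le_one hQ0]; push_cast; linarith
    · exact chord_le_two _
    · have h2 : (k : ℝ) + 1 ≤ m + r + 1 := by exact_mod_cast hd
      have h3 : (m : ℝ) + 1 ≤ k := by exact_mod_cast (by omega : m + 1 ≤ k)
      apply chord_le_chord'
      · exact div_le_div_of_nonneg_right (by linarith) hQ0.le
      · rw [div_le_one hQ0]; linarith
      · rw [← add_div, one_le_div hQ0]; linarith
    · obtain rfl : k = m + r + 1 := by omega
      rcases le_total (((m + r + 1 : ℕ) : ℝ) + θ + e) Q with h | h
      · refine le_max_of_le_left (chord_le_chord' ?_ ?_ ?_)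
        · exact div_le_div_of_nonneg_right (by linarith) hQ0.le
        · rwa [div_le_one hQ0]
        · rw [← add_div, one_le_div hQ0]; push_cast; linarith
      · refine le_max_of_le_right ?_
        have e1 := chord_add_int ((((m + r + 1 : ℕ) : ℝ) + θ + e) / Q - 1) 1
        rw [Int.cast_one, sub_add_cancel] at e1
        have e2 : (((m + r + 1 : ℕ) : ℝ) + θ + e) / Q - 1 = (θ + e - 1) / Q := by
          field_simp; rw [hQ']; push_cast; ring
        rw [e1, e2]
        push_cast at h
        apply chord_le_chord
        · apply div_nonneg _ hQ0.le; linarith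
        · exact div_le_div_of_nonneg_right (by push_cast; linarith) hQ0.le
        · rw [← add_div, div_le_one hQ0]; push_cast; linarith
  · set A : ℝ := ∏ k ∈ Finset.range (m + r), c (k + 1) with hA
    have hA0 : 0 ≤ A := Finset.prod_nonneg fun k _ => c_nonneg _
    have hprod : ∏ k ∈ Finset.range (m + r + 2), M k = 2 * (A * max (c (m + r + 1)) (c 0)) := by
      rw [show m + r + 2 = (m + 1 + r) + 1 by ring, Finset.prod_range_succ, Finset.prod_range_add,
        Finset.prod_range_succ, hA, Finset.prod_range_add]
      have h1 : ∏ k ∈ Finset.range m, M k = ∏ k ∈ Finset.range m, c (k + 1) :=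
        Finset.prod_congr rfl fun k hk => by simp [hM, Finset.mem_range.1 hk]
      have h2 : M m = 2 := by simp [hM]
      have h3 : ∏ k ∈ Finset.range r, M (m + 1 + k) = ∏ k ∈ Finset.range r, c (m + k + 1) :=
        Finset.prod_congr rfl fun k hk => by
          have := Finset.mem_range.1 hk
          simp only [hM]
          rw [if_neg (by omega), if_neg (by omega), if_pos (by omega)]
          congr 1; ring
      have h4 : M (m + 1 + r) = max (c (m + r + 1)) (c 0) := by
        simp only [hM]
        rw [if_neg (by omega), if_neg (by omega), if_neg (by omega)]
        congr 2; ring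
      rw [h1, h2, h3, h4]; ring
    have hq : ((m + r + 1 : ℕ) : ℝ) + 1 = Q := by rw [hQ']; push_cast; ring
    have hB : A * c (m + r + 1) ≤ Q := by
      rw [hA, ← Finset.prod_range_succ (fun k => c (k + 1))]
      have := prod_chord_le (m + r + 1) θ
      rw [hq] at this
      simpa [hc] using this
    have hC : A * c 0 ≤ Q := by
      rw [hA, ← Finset.prod_range_succ' c]
      -- The factors c 0, …, c (m + r) are again Q - 1 consecutive lattice points, with the rotation
      -- shifted by one cell.
      have := prod_chord_le (m + r + 1) (θ - 1)
      rw [hq] at this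
      convert this using 3
      ring
    rw [hprod, mul_max_of_nonneg _ _ hA0]
    have := max_le hB hC
    linarith

lemma prod_comp_mod_eq {q : ℕ} (hq : 0 < q) {p : ℤ} (hcop : IsCoprime p q) (j : ℤ) (f : ℕ → ℝ) :
    ∏ i ∈ Finset.range q, f (((i + 1) * p + j) % q).toNat = ∏ k ∈ Finset.range q, f k := by
  have hq' : (0 : ℤ) < q := by exact_mod_cast hq
  have hinj : Set.InjOn (fun i : ℕ => ((((i : ℤ) + 1) * p + j) % q).toNat) (Finset.range q) := by
    intro a ha b hb hab
    have ha' := Finset.mem_range.1 ha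
    have hb' := Finset.mem_range.1 hb
    have h1 := Int.emod_nonneg (((a : ℤ) + 1) * p + j) hq'.ne'
    have h2 := Int.emod_nonneg (((b : ℤ) + 1) * p + j) hq'.ne'
    simp only at hab
    have h3 : (((a : ℤ) + 1) * p + j) % q = (((b : ℤ) + 1) * p + j) % q := by omega
    have h4 : (q : ℤ) ∣ ((b : ℤ) - a) * p := by
      have := Int.ModEq.dvd h3
      convert this using 1; ring
    have h5 : (q : ℤ) ∣ (b : ℤ) - a := hcop.symm.dvd_of_dvd_mul_right h4
    have h6 := Int.eq_zero_of_abs_lt_dvd h5 (by rw [abs_lt]; omega)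
    omega
  rw [← Finset.prod_image (f := f) hinj]
  congr 1
  refine Finset.eq_of_subset_of_card_le ?_ ?_
  · intro k hk
    obtain ⟨a, -, rfl⟩ := Finset.mem_image.1 hk
    have h1 := Int.emod_nonneg (((a : ℤ) + 1) * p + j) hq'.ne'
    have h2 := Int.emod_lt_of_pos (((a : ℤ) + 1) * p + j) hq'
    simp only [Finset.mem_range]
    omega
  · rw [Finset.card_image_of_injOn hinj]

lemma chord_div_eq_chord_mod {q : ℕ} (hq : 0 < q) (m : ℤ) (s : ℝ) :
    chord ((m + s) / q) = chord (((m % q).toNat + s) / q) := by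
  have hq' : (0 : ℤ) < q := by exact_mod_cast hq
  have hqr : (0 : ℝ) < q := by exact_mod_cast hq
  rw [← chord_add_int (((m % q).toNat + s) / q) (m / q)]
  congr 1
  have h1 : (((m % q).toNat : ℤ) : ℝ) = ((m % q : ℤ) : ℝ) := by
    rw [Int.toNat_of_nonneg (Int.emod_nonneg m hq'.ne')]
  have h2 : (m : ℝ) = ((m % q : ℤ) : ℝ) + q * ((m / q : ℤ) : ℝ) := by
    exact_mod_cast (Int.emod_add_mul_ediv m q).symm
  rw [Int.cast_natCast] at h1
  rw [h1, h2]
  field_simp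
  ring

/-- A Denjoy–Koksma type bound: a block of `q` consecutive factors of the shifted sine product is at
most `2q` if `p / q` is a sufficiently good approximation of `α`. -/
lemma prod_chord_block_le {q : ℕ} (hq : 0 < q) {p : ℤ} (hcop : IsCoprime p q) {α : ℝ}
    (hα : q * |q * α - p| ≤ 1) (x : ℝ) :
    ∏ i ∈ Finset.range q, chord (x + (i + 1) * α) ≤ 2 * q := by
  have hqr : (0 : ℝ) < q := by exact_mod_cast hq
  -- For q = 1, 2 the trivial bound 2^q equals 2q; the majorant needs the cell containing 1/2 to
  -- differ from the last cell.
  rcases lt_or_ge q 3 with h3 | h3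
  · have : ∏ i ∈ Finset.range q, chord (x + (i + 1) * α) ≤ 2 ^ q := by
      refine (Finset.prod_le_prod (fun i _ => chord_nonneg _) fun i _ => chord_le_two _).trans ?_
      simp
    interval_cases q <;> norm_num at this ⊢ <;> linarith
  -- The drift (i+1)(qα - p) lies in [0,1] or in [-1,0] according to the sign of qα - p; adding s
  -- brings it into [0,1], and the lattice is moved back by s to compensate.
  obtain ⟨s, hs⟩ : ∃ s : ℝ, s = if 0 ≤ q * α - p then 0 else 1 := ⟨_, rfl⟩
  have hdrift : ∀ i < q, 0 ≤ ((i : ℝ) + 1) * (q * α - p) + s ∧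
      ((i : ℝ) + 1) * (q * α - p) + s ≤ 1 := by
    intro i hi
    have hi' : (i : ℝ) + 1 ≤ q := by exact_mod_cast hi
    have hi0 : (0 : ℝ) ≤ i := Nat.cast_nonneg _
    split_ifs at hs with h
    · rw [abs_of_nonneg h] at hα
      subst hs
      constructor
      · positivity
      · nlinarith
    · push Not at h
      rw [abs_of_neg h] at hα
      subst hs
      constructor <;> nlinarith
  set j : ℤ := ⌊q * x - s⌋ with hj
  set θ : ℝ := Int.fract (q * x - s) with hθ
  have hjθ : (j : ℝ) + θ = q * x - s := Int.floor_add_fract _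
  have hθ0 : 0 ≤ θ := Int.fract_nonneg _
  have hθ1 : θ < 1 := Int.fract_lt_one _
  have hq3 : (3 : ℝ) ≤ q := by exact_mod_cast h3
  obtain ⟨m, hm⟩ : ∃ m : ℕ, m = ⌊q / 2 - θ⌋₊ := ⟨_, rfl⟩
  have hm1 : (m : ℝ) ≤ q / 2 - θ := hm ▸ Nat.floor_le (by linarith)
  have hm2 : q / 2 - θ < m + 1 := hm ▸ Nat.lt_floor_add_one _
  have hmq : m + 2 ≤ q := by
    have : (2 * m : ℝ) ≤ q := by linarith
    have : 2 * m ≤ q := by exact_mod_cast this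
    omega
  obtain ⟨r, rfl⟩ : ∃ r, q = m + r + 2 := ⟨q - m - 2, by omega⟩
  obtain ⟨M, hM, hprod⟩ := exists_cell_majorant (m := m) (r := r) hθ0 hθ1.le
    (by linarith) (by linarith)
  refine le_trans ?_ hprod
  rw [← prod_comp_mod_eq hq hcop j M]
  refine Finset.prod_le_prod (fun i _ => chord_nonneg _) fun i hi => ?_
  have hi := Finset.mem_range.1 hi
  obtain ⟨hd0, hd1⟩ := hdrift i hi
  have e : x + (i + 1) * α = ((((i + 1) * p + j : ℤ) : ℝ) +
      (θ + (((i : ℝ) + 1) * (((m + r + 2 : ℕ) : ℝ) * α - p) + s))) / ((m + r + 2 : ℕ) : ℝ) := by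
    rw [eq_div_iff hqr.ne']
    push_cast at hjθ ⊢
    linarith
  rw [e, chord_div_eq_chord_mod hq, ← add_assoc]
  refine hM _ ?_ _ hd0 hd1
  have hq' : (0 : ℤ) < ((m + r + 2 : ℕ) : ℤ) := by exact_mod_cast hq
  have h1 := Int.emod_nonneg (((i : ℤ) + 1) * p + j) hq'.ne'
  have h2 := Int.emod_lt_of_pos (((i : ℤ) + 1) * p + j) hq'
  omega

/-! ### Lower bound for the first q - 1 factors -/

lemma le_prod_chord_of_nonneg {a b : ℕ} (hab : a ≤ b + 1) (hba : b ≤ a + 1) {p : ℤ}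
    (hcop : IsCoprime p ((a + b + 2 : ℕ) : ℤ)) {α : ℝ}
    (h0 : 0 ≤ ((a + b + 2 : ℕ) : ℝ) * α - p)
    (hα : ((a + b + 2 : ℕ) : ℝ) * (((a + b + 2 : ℕ) : ℝ) * α - p) ≤ 1) :
    2 / ((a + b + 2 : ℕ) : ℝ) ≤ ∏ i ∈ Finset.range (a + b + 1), chord ((i + 1) * α) := by
  have hq : 0 < a + b + 2 := by omega
  have hq' : (0 : ℤ) < ((a + b + 2 : ℕ) : ℤ) := by exact_mod_cast hq
  set Q : ℝ := ((a + b + 2 : ℕ) : ℝ) with hQ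
  have hQ' : Q = a + b + 2 := by rw [hQ]; push_cast; ring
  have ha0 : (0 : ℝ) ≤ a := Nat.cast_nonneg _
  have hb0 : (0 : ℝ) ≤ b := Nat.cast_nonneg _
  have hab' : (a : ℝ) ≤ b + 1 := by exact_mod_cast hab
  have hba' : (b : ℝ) ≤ a + 1 := by exact_mod_cast hba
  have hQ0 : 0 < Q := by linarith
  have hQ2 : 2 ≤ Q := by linarith
  set c : ℕ → ℝ := fun k => chord ((k : ℝ) / Q) with hc
  have c_nonneg : ∀ k, 0 ≤ c k := fun k => chord_nonneg _
  -- Each cell takes its smaller endpoint value. In the last cell that would be 0, but the drift is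
  -- at most 1 - 1/Q, so the point stays 1/Q² away from 1 and its chord is at least 4/Q². The value
  -- 1 at k = 0 is padding: no point has residue 0, yet the product can then run over all residues.
  set L : ℕ → ℝ := fun k => if k = 0 then 1 else if k < a + 1 then c k else
    if k < a + b + 1 then c (k + 1) else 4 / Q ^ 2 with hL
  have L_nonneg : ∀ k, 0 ≤ L k := by
    intro k
    simp only [hL]
    split_ifs
    exacts [zero_le_one, c_nonneg _, c_nonneg _, by positivity]
  have hcell : ∀ k < a + b + 2, k ≠ 0 → ∀ e : ℝ, 0 ≤ e → e ≤ 1 - 1 / Q →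
      L k ≤ chord ((k + e) / Q) := by
    intro k hk hk0 e he0 he1
    have hk0' : (0 : ℝ) ≤ k := Nat.cast_nonneg _
    have hQi : 0 < 1 / Q := by positivity
    have hek : ((k : ℝ) + e) / Q ≤ ((k + 1 : ℕ) : ℝ) / Q :=
      div_le_div_of_nonneg_right (by push_cast; linarith) hQ0.le
    have hke : (k : ℝ) / Q ≤ ((k : ℝ) + e) / Q :=
      div_le_div_of_nonneg_right (by linarith) hQ0.le
    have hk1 : ((k + 1 : ℕ) : ℝ) / Q ≤ 1 := by
      rw [div_le_one hQ0, hQ]; exact_mod_cast Nat.succ_le_of_lt hk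
    have hmin := min_chord_le (by positivity) hke hek hk1
    simp only [hL, if_neg hk0]
    split_ifs with h1 h2
    · have h1' : (k : ℝ) ≤ a := by exact_mod_cast (by omega : k ≤ a)
      refine le_trans (le_min le_rfl ?_) hmin
      apply chord_le_chord (by positivity) (hke.trans hek)
      rw [← add_div, div_le_one hQ0]; push_cast; linarith
    · have h1' : (a : ℝ) + 1 ≤ k := by exact_mod_cast (by omega : a + 1 ≤ k)
      refine le_trans (le_min ?_ le_rfl) hmin
      apply chord_le_chord' (hke.trans hek) hk1
      rw [← add_div, one_le_div hQ0]; push_cast; linarith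
    · obtain rfl : k = a + b + 1 := by omega
      rw [← chord_one_sub]
      have e1 : 1 - (((a + b + 1 : ℕ) : ℝ) + e) / Q = (1 - e) / Q := by
        field_simp; rw [hQ']; push_cast; ring
      rw [e1]
      refine le_trans ?_ (four_mul_le_chord ?_ ?_)
      · rw [show 4 / Q ^ 2 = 4 * ((1 / Q) / Q) by field_simp]
        have := div_le_div_of_nonneg_right (by linarith : 1 / Q ≤ 1 - e) hQ0.le
        linarith
      · exact div_nonneg (by linarith) hQ0.le
      · rw [div_le_div_iff₀ hQ0 two_pos]; linarith
  have hLprod : ∏ k ∈ Finset.range (a + b + 2), L k ≤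
      ∏ i ∈ Finset.range (a + b + 1), chord ((i + 1) * α) := by
    rw [← prod_comp_mod_eq hq hcop 0 L, show a + b + 2 = a + b + 1 + 1 by ring,
      Finset.prod_range_succ]
    have hlast : (((((a + b + 1 : ℕ) : ℤ) + 1) * p + 0) % ((a + b + 1 + 1 : ℕ) : ℤ)).toNat = 0 := by
      rw [show (((a + b + 1 : ℕ) : ℤ) + 1) * p + 0 = ((a + b + 1 + 1 : ℕ) : ℤ) * p by
        push_cast; ring, Int.mul_emod_right]
      rfl
    rw [hlast, show L 0 = 1 by simp [hL], mul_one]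
    refine Finset.prod_le_prod (fun i _ => L_nonneg _) fun i hi => ?_
    have hi := Finset.mem_range.1 hi
    have hiQ : (i : ℝ) + 1 ≤ Q - 1 := by
      rw [hQ']
      have : (i : ℝ) + 1 ≤ a + b + 1 := by exact_mod_cast hi
      linarith
    have e : ((i : ℝ) + 1) * α = ((((i + 1) * p + 0 : ℤ) : ℝ) + ((i : ℝ) + 1) * (Q * α - p)) / Q := by
      rw [eq_div_iff hQ0.ne']
      push_cast
      ring
    rw [e, hQ, chord_div_eq_chord_mod hq]
    have h1 := Int.emod_nonneg (((i : ℤ) + 1) * p + 0) hq'.ne'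
    have h2 := Int.emod_lt_of_pos (((i : ℤ) + 1) * p + 0) hq'
    have h3 : (((i : ℤ) + 1) * p + 0) % ((a + b + 2 : ℕ) : ℤ) ≠ 0 := by
      intro h
      have h4 := Int.dvd_of_emod_eq_zero h
      rw [add_zero] at h4
      have h5 := hcop.symm.dvd_of_dvd_mul_right h4
      have h6 := Int.le_of_dvd (by omega) h5
      push_cast at h6
      omega
    change L ((((i : ℤ) + 1) * p + 0) % ((a + b + 2 : ℕ) : ℤ)).toNat ≤ _
    refine hcell _ ?_ ?_ _ (by positivity) ?_
    · omega
    · omega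
    · have : ((i : ℝ) + 1) * (Q * α - p) ≤ (Q - 1) * (Q * α - p) := by gcongr
      have h5 : Q * α - p ≤ 1 / Q := by rw [le_div_iff₀ hQ0]; linarith
      have h6 : (Q - 1) * (Q * α - p) ≤ (Q - 1) * (1 / Q) :=
        mul_le_mul_of_nonneg_left h5 (by linarith)
      have h7 : (Q - 1) * (1 / Q) = 1 - 1 / Q := by field_simp
      linarith
  refine le_trans ?_ hLprod
  set A : ℝ := ∏ k ∈ Finset.range a, c (k + 1) with hA
  set B : ℝ := ∏ k ∈ Finset.range b, c (a + 1 + k + 1) with hB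
  have hABc : A * c (a + 1) * B = Q := by
    have := prod_chord_eq (a + b + 1)
    rw [show ((a + b + 1 : ℕ) : ℝ) + 1 = Q by rw [hQ']; push_cast; ring] at this
    rw [← this, show a + b + 1 = a + 1 + b by ring, Finset.prod_range_add, Finset.prod_range_succ]
    simp [hA, hB, hc]
  have hAB : ∏ k ∈ Finset.range (a + b + 2), L k = A * B * (4 / Q ^ 2) := by
    rw [show a + b + 2 = (a + b) + 1 + 1 by ring, Finset.prod_range_succ', Finset.prod_range_succ,
      Finset.prod_range_add]
    have h1 : ∏ k ∈ Finset.range a, L (k + 1) = A :=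
      Finset.prod_congr rfl fun k hk => by simp [hL, Finset.mem_range.1 hk]
    have h2 : ∏ k ∈ Finset.range b, L (a + k + 1) = B :=
      Finset.prod_congr rfl fun k hk => by
        have := Finset.mem_range.1 hk
        simp only [hL]
        rw [if_neg (by omega), if_neg (by omega), if_pos (by omega)]
        congr 1; ring
    have h3 : L (a + b + 1) = 4 / Q ^ 2 := by simp [hL]
    have h4 : L 0 = 1 := by simp [hL]
    rw [h1, h2, h3, h4, mul_one]
  have hA0 : 0 ≤ A := Finset.prod_nonneg fun k _ => c_nonneg _
  have hB0 : 0 ≤ B := Finset.prod_nonneg fun k _ => c_nonneg _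
  -- Only the middle chord c (a + 1) is missing from the full lattice product Q, and it is at most
  -- 2.
  have hAB2 : Q ≤ A * B * 2 := by
    rw [← hABc, mul_right_comm]
    exact mul_le_mul_of_nonneg_left (chord_le_two _) (by positivity)
  rw [hAB, show 2 / Q = (Q / 2) * (4 / Q ^ 2) by field_simp; norm_num]
  gcongr
  linarith

/-- Lower bound for the sine product of length `q - 1` if `p / q` is a sufficiently good
approximation of `α`. -/
lemma le_prod_chord {q : ℕ} (hq : 2 ≤ q) {p : ℤ} (hcop : IsCoprime p q) {α : ℝ}
    (hα : q * |q * α - p| ≤ 1) :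
    2 / (q : ℝ) ≤ ∏ i ∈ Finset.range (q - 1), chord ((i + 1) * α) := by
  obtain ⟨a, b, rfl, hab, hba⟩ : ∃ a b : ℕ, q = a + b + 2 ∧ a ≤ b + 1 ∧ b ≤ a + 1 :=
    ⟨q / 2 - 1, q - q / 2 - 1, by omega, by omega, by omega⟩
  rw [show a + b + 2 - 1 = a + b + 1 by omega]
  rcases le_total 0 (((a + b + 2 : ℕ) : ℝ) * α - p) with h | h
  · exact le_prod_chord_of_nonneg hab hba hcop h (by rwa [abs_of_nonneg h] at hα)
  · rw [abs_of_nonpos h] at hα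
    -- Reflection α ↦ -α preserves chords and reverses the drift.
    have := le_prod_chord_of_nonneg hab hba (p := -p) (α := -α) hcop.neg_left
      (by push_cast at h ⊢; linarith) (by push_cast at hα ⊢; linarith)
    simpa only [mul_neg, chord_neg] using this

/-! ### Convergents of an irrational number -/

lemma not_terminatedAt_of_irrational {α : ℝ} (hα : Irrational α) (n : ℕ) :
    ¬(GenContFract.of α).TerminatedAt n := by
  intro h
  obtain ⟨r, hr⟩ := GenContFract.exists_rat_eq_of_terminates ⟨n, h⟩
  exact hα ⟨r, hr.symm⟩

lemma exists_partial_quotient {α : ℝ} (hα : Irrational α) (n : ℕ) :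
    ∃ a : ℕ, 1 ≤ a ∧ (GenContFract.of α).s.get? n = some ⟨1, (a : ℝ)⟩ := by
  obtain ⟨gp, hgp⟩ := Option.ne_none_iff_exists'.1 (not_terminatedAt_of_irrational hα n)
  obtain ⟨h1, z, hz⟩ := GenContFract.of_partNum_eq_one_and_exists_int_partDen_eq hgp
  have h2 : 1 ≤ gp.b := GenContFract.of_one_le_get?_partDen
    (GenContFract.partDen_eq_s_b hgp)
  rw [hz] at h2
  have h3 : 1 ≤ z := by exact_mod_cast h2
  lift z to ℕ using by omega
  refine ⟨z, by exact_mod_cast h3, ?_⟩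
  rw [hgp]
  congr 1
  cases gp
  simp_all

/-- The convergents of an irrational number, as integer sequences. -/
lemma exists_convergents {α : ℝ} (hα : Irrational α) :
    ∃ (q : ℕ → ℕ) (p : ℕ → ℤ), (∀ l, bestDen α l = q l) ∧ q 0 = 1 ∧ Monotone q ∧
      (∀ l, q l + q (l + 1) ≤ q (l + 2)) ∧
      ∀ l, IsCoprime (p l) (q l) ∧ (q l : ℝ) * |q l * α - p l| ≤ 1 := by
  choose a ha has using exists_partial_quotient hα
  set g := GenContFract.of α with hg
  have hex : ∀ l, ∃ q q' : ℕ, ∃ p p' : ℤ, g.dens l = q ∧ g.dens (l + 1) = q' ∧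
      g.nums l = p ∧ g.nums (l + 1) = p' := by
    intro l
    induction l with
    | zero =>
      refine ⟨1, a 0, ⌊α⌋, a 0 * ⌊α⌋ + 1, ?_, ?_, ?_, ?_⟩
      · simp
      · rw [zero_add, GenContFract.first_den_eq (has 0)]
      · rw [GenContFract.zeroth_num_eq_h, hg, GenContFract.of_h_eq_floor]
      · rw [zero_add, GenContFract.first_num_eq (has 0), hg, GenContFract.of_h_eq_floor]
        push_cast; ring
    | succ l ih =>
      obtain ⟨q, q', p, p', h1, h2, h3, h4⟩ := ih
      refine ⟨q', a (l + 1) * q' + q, p', a (l + 1) * p' + p, h2, ?_, h4, ?_⟩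
      · rw [GenContFract.dens_recurrence (has (l + 1)) h1 h2]; push_cast; ring
      · rw [GenContFract.nums_recurrence (has (l + 1)) h3 h4]; push_cast; ring
  choose q _ p _ hq _ hp _ using hex
  have hq0 : q 0 = 1 := by
    have := hq 0
    rw [GenContFract.zeroth_den_eq_one] at this
    exact_mod_cast this.symm
  have hmono : Monotone q := monotone_nat_of_le_succ fun l => by
    have : g.dens l ≤ g.dens (l + 1) := GenContFract.of_den_mono
    rw [hq, hq] at this
    exact_mod_cast this
  refine ⟨q, p, hq, hq0, hmono, fun l => ?_, fun l => ⟨?_, ?_⟩⟩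
  · have h := GenContFract.dens_recurrence (has (l + 1)) (hq l) (hq (l + 1))
    rw [hq] at h
    dsimp only at h
    have h' : q (l + 2) = a (l + 1) * q (l + 1) + 1 * q l := by exact_mod_cast h
    nlinarith [ha (l + 1)]
  · have h := SimpContFract.determinant (s := SimpContFract.of α) (n := l)
      (not_terminatedAt_of_irrational hα l)
    change g.nums l * g.dens (l + 1) - g.dens l * g.nums (l + 1) = _ at h
    rw [hq, hq, hp, hp] at h
    have h' : p l * (q (l + 1) : ℤ) - q l * p (l + 1) = (-1) ^ (l + 1) := by exact_mod_cast h
    have h2 : ((-1 : ℤ) ^ (l + 1)) * (-1) ^ (l + 1) = 1 := by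
      rw [← mul_pow]; simp
    -- The determinant identity of consecutive convergents, multiplied by its own sign, is a Bézout
    -- relation.
    refine ⟨(-1) ^ (l + 1) * q (l + 1), -((-1) ^ (l + 1) * p (l + 1)), ?_⟩
    linear_combination (-1) ^ (l + 1) * h' + h2
  · have h := GenContFract.abs_sub_convs_le (not_terminatedAt_of_irrational hα l)
    change |α - g.convs l| ≤ 1 / (g.dens l * g.dens (l + 1)) at h
    rw [GenContFract.conv_eq_num_div_den, hq, hq, hp] at h
    have hpos : 0 < q l := lt_of_lt_of_le (by omega) (hmono (Nat.zero_le l))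
    have hposr : (0 : ℝ) < q l := by exact_mod_cast hpos
    have hle : (q l : ℝ) ≤ q (l + 1) := by exact_mod_cast hmono (Nat.le_succ l)
    have e : |q l * α - p l| = q l * |α - p l / q l| := by
      rw [← abs_of_pos hposr, ← abs_mul, abs_of_pos hposr]
      congr 1; field_simp
    have h2 : 1 / ((q l : ℝ) * q (l + 1)) ≤ 1 / (q l * q l) := by gcongr
    rw [e]
    calc (q l : ℝ) * (q l * |α - p l / q l|) ≤ q l * (q l * (1 / (q l * q l))) := by
          gcongr; exact h.trans h2
      _ = 1 := by field_simp

/-! ### Greedy decomposition into blocks -/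

lemma log_two_mul_div_antitone {m n : ℕ} (hm : 1 ≤ m) (hmn : m ≤ n) :
    Real.log (2 * n) / n ≤ Real.log (2 * m) / m := by
  induction n, hmn using Nat.le_induction with
  | base => exact le_rfl
  | succ n hn ih =>
    refine le_trans ?_ ih
    have hn1 : (1 : ℝ) ≤ n := by exact_mod_cast hm.trans hn
    -- log(y)/y decreases only from y = e on, so y = 2n requires n ≥ 2; from n = 1 to n = 2 the
    -- values agree, since log 4 = 2 log 2.
    rcases eq_or_lt_of_le (hm.trans hn) with h | h
    · subst h
      have : Real.log 4 = 2 * Real.log 2 := by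
        rw [show (4 : ℝ) = 2 ^ 2 by norm_num, Real.log_pow]; norm_num
      norm_num
      rw [this]; linarith
    · have hn2 : (2 : ℝ) ≤ n := by exact_mod_cast h
      have he := Real.exp_one_lt_d9
      have hanti := Real.log_div_self_antitoneOn (a := 2 * n) (b := 2 * ((n + 1 : ℕ) : ℝ))
        (by change Real.exp 1 ≤ _; linarith)
        (by change Real.exp 1 ≤ _; push_cast; linarith) (by push_cast; linarith)
      simp only at hanti
      rw [mul_comm (2 : ℝ) (n : ℝ), mul_comm (2 : ℝ) ((n + 1 : ℕ) : ℝ), ← div_div, ← div_div] at hanti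
      rw [mul_comm (2 : ℝ) (n : ℝ), mul_comm (2 : ℝ) ((n + 1 : ℕ) : ℝ)]
      linarith

lemma one_le_den {q : ℕ → ℕ} (hq0 : q 0 = 1) (hmono : Monotone q)
    (l : ℕ) : 1 ≤ q l := hq0 ▸ hmono (Nat.zero_le l)

lemma fib_mul_den_le {q : ℕ → ℕ} (hmono : Monotone q) (hfib : ∀ l, q l + q (l + 1) ≤ q (l + 2))
    (j k : ℕ) : Nat.fib (k + 1) * q j ≤ q (j + k) := by
  induction k using Nat.strong_induction_on with
  | _ k ih =>
    match k with
    | 0 => simp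
    | 1 => simpa using hmono (Nat.le_succ j)
    | k + 2 =>
      have h1 := ih k (by omega)
      have h2 := ih (k + 1) (by omega)
      have h3 := hfib (j + k)
      rw [show k + 2 + 1 = (k + 1) + 2 by ring, Nat.fib_add_two, add_mul]
      calc _ ≤ q (j + k) + q (j + (k + 1)) := add_le_add h1 h2
        _ ≤ _ := h3

lemma fib_le_den {q : ℕ → ℕ} (hq0 : q 0 = 1) (hmono : Monotone q)
    (hfib : ∀ l, q l + q (l + 1) ≤ q (l + 2))
    (l : ℕ) : Nat.fib (l + 1) ≤ q l := by
  have := fib_mul_den_le hmono hfib 0 l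
  rwa [hq0, mul_one, zero_add] at this

lemma lt_den {q : ℕ → ℕ} (hq0 : q 0 = 1) (hmono : Monotone q)
    (hfib : ∀ l, q l + q (l + 1) ≤ q (l + 2))
    (n : ℕ) : n < q (n + 1) := by
  have h1 := fib_le_den hq0 hmono hfib (n + 1)
  have h2 := Nat.le_fib_add_one (n + 1 + 1)
  omega

/-- The largest possible block is removed from the front and the rest is a product with a shifted
starting point, which is why x is arbitrary. The cost log(2q_l) of the block is spread evenly over
the q_l largest indices r + 1, …, N; all are below q_{l+1}, so γ covers each share. -/
lemma prod_chord_le_exp_sum {q : ℕ → ℕ} (hq0 : q 0 = 1) (hmono : Monotone q)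
    (hfib : ∀ l, q l + q (l + 1) ≤ q (l + 2))
    {α : ℝ} (p : ℕ → ℤ)
    (hp : ∀ l, IsCoprime (p l) (q l) ∧ (q l : ℝ) * |q l * α - p l| ≤ 1) {γ : ℕ → ℝ}
    (hγ : ∀ l n, n < q (l + 1) → Real.log (2 * q l) / q l ≤ γ n) (N : ℕ) (x : ℝ) :
    ∏ i ∈ Finset.range N, chord (x + (i + 1) * α) ≤
      Real.exp (∑ n ∈ Finset.Ico 1 (N + 1), γ n) := by
  induction N using Nat.strong_induction_on generalizing x with
  | _ N ih =>
    rcases Nat.eq_zero_or_pos N with rfl | hN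
    · simp
    obtain ⟨l, hl1, hl2⟩ : ∃ l, q l ≤ N ∧ N < q (l + 1) := by
      have hex : ∃ l, N < q (l + 1) := ⟨N, lt_den hq0 hmono hfib N⟩
      refine ⟨Nat.find hex, ?_, Nat.find_spec hex⟩
      rcases h : Nat.find hex with _ | l
      · omega
      · exact not_lt.1 (Nat.find_min hex (by omega))
    have hl := one_le_den hq0 hmono l
    have hlr : (0 : ℝ) < q l := by exact_mod_cast hl
    obtain ⟨r, rfl⟩ := Nat.exists_eq_add_of_le hl1
    have h1 := prod_chord_block_le hl (hp l).1 (hp l).2 x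
    have h2 := ih r (by omega) (x + q l * α)
    have h3 : ∏ i ∈ Finset.range r, chord (x + (((q l + i : ℕ) : ℝ) + 1) * α) =
        ∏ i ∈ Finset.range r, chord (x + q l * α + (i + 1) * α) :=
      Finset.prod_congr rfl fun i _ => by congr 1; push_cast; ring
    rw [Finset.prod_range_add, h3, ← Finset.sum_Ico_consecutive γ (by omega : 1 ≤ r + 1)
      (by omega : r + 1 ≤ q l + r + 1), add_comm (Finset.sum _ _), Real.exp_add]
    refine mul_le_mul (h1.trans ?_) h2 (Finset.prod_nonneg fun i _ => chord_nonneg _)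
      (Real.exp_pos _).le
    rw [← Real.log_le_iff_le_exp (by positivity)]
    have h4 : ∑ n ∈ Finset.Ico (r + 1) (q l + r + 1), Real.log (2 * q l) / q l ≤
        ∑ n ∈ Finset.Ico (r + 1) (q l + r + 1), γ n :=
      Finset.sum_le_sum fun n hn => hγ l n (by have := Finset.mem_Ico.1 hn; omega)
    rw [Finset.sum_const, Nat.card_Ico, show q l + r + 1 - (r + 1) = q l by omega,
      nsmul_eq_mul, mul_div_cancel₀ _ hlr.ne'] at h4
    exact h4

/-- Decomposing an interval greedily into blocks whose lengths are convergent denominators. -/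
lemma prod_chord_le_exp {q : ℕ → ℕ} (hq0 : q 0 = 1) (hmono : Monotone q)
    (hfib : ∀ l, q l + q (l + 1) ≤ q (l + 2))
    {α : ℝ} (p : ℕ → ℤ)
    (hp : ∀ l, IsCoprime (p l) (q l) ∧ (q l : ℝ) * |q l * α - p l| ≤ 1) {l N : ℕ}
    (hlN : q l ≤ N) :
    ∏ i ∈ Finset.range N, chord ((i + 1) * α) ≤
      Real.exp ((∑ j ∈ Finset.range l, ((q (j + 1) : ℝ) - q j) * (Real.log (2 * q j) / q j)) +
        N * (Real.log (2 * q l) / q l)) := by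
  have hex : ∀ n, ∃ l, n < q (l + 1) := fun n => ⟨n, lt_den hq0 hmono hfib n⟩
  set g : ℕ → ℝ := fun j => Real.log (2 * q j) / q j with hg
  have hganti : Antitone g := fun i j hij =>
    log_two_mul_div_antitone (one_le_den hq0 hmono i) (hmono hij)
  have hg0 : ∀ j, 0 ≤ g j := fun j => by
    have : (1 : ℝ) ≤ q j := by exact_mod_cast one_le_den hq0 hmono j
    exact div_nonneg (Real.log_nonneg (by linarith)) (by linarith)
  -- For n ≥ 1 this is g at the level l with q_l ≤ n < q_{l+1}.
  set γ : ℕ → ℝ := fun n => g (Nat.find (hex n)) with hγdef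
  have hγ : ∀ l n, n < q (l + 1) → Real.log (2 * q l) / q l ≤ γ n := fun l n hn =>
    hganti (Nat.find_min' (hex n) hn)
  have hγeq : ∀ l n, q l ≤ n → γ n ≤ g l := by
    intro l n hn
    refine hganti ?_
    by_contra! h
    have h1 := Nat.find_spec (hex n)
    have h2 := hmono (Nat.succ_le_of_lt h)
    exact absurd h1 (not_lt.2 (h2.trans hn))
  have h := prod_chord_le_exp_sum hq0 hmono hfib p hp hγ N 0
  simp only [zero_add] at h
  refine h.trans (Real.exp_le_exp.2 ?_)
  have hl1 := one_le_den hq0 hmono l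
  have hV : ∀ m, ∑ n ∈ Finset.Ico 1 (q m), γ n ≤
      ∑ j ∈ Finset.range m, ((q (j + 1) : ℝ) - q j) * g j := by
    intro m
    induction m with
    | zero => simp [hq0]
    | succ m ih =>
      rw [Finset.sum_range_succ, ← Finset.sum_Ico_consecutive γ (one_le_den hq0 hmono m)
        (hmono (Nat.le_succ m))]
      refine add_le_add ih ?_
      refine (Finset.sum_le_sum fun n hn => hγeq m n (Finset.mem_Ico.1 hn).1).trans ?_
      rw [Finset.sum_const, Nat.card_Ico, nsmul_eq_mul, Nat.cast_sub (hmono (Nat.le_succ m))]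
  rw [← Finset.sum_Ico_consecutive γ hl1 (by omega : q l ≤ N + 1)]
  refine add_le_add (hV l) ?_
  refine (Finset.sum_le_sum fun n hn => hγeq l n (Finset.mem_Ico.1 hn).1).trans ?_
  rw [Finset.sum_const, Nat.card_Ico, nsmul_eq_mul]
  refine mul_le_mul_of_nonneg_right ?_ (hg0 l)
  exact_mod_cast (by omega : N + 1 - q l ≤ N)

/-! ### Fibonacci estimates for the block costs -/

/-- By Abel summation the interior x_j enter with the nonnegative weights g_{j-1} - g_j, so raising
them to u_j only increases the sum. The initial value enters with weight -g_0, which the term u_0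
g_0 compensates. -/
lemma sum_sub_mul_le {g x u : ℕ → ℝ} {l : ℕ} (hg : Antitone g) (hg0 : 0 ≤ g 0)
    (hx0 : 0 ≤ x 0) (hxu : ∀ j ≤ l, x j ≤ u j) (hl : x l = u l) :
    ∑ j ∈ Finset.range l, (x (j + 1) - x j) * g j ≤
      ∑ j ∈ Finset.range l, (u (j + 1) - u j) * g j + u 0 * g 0 := by
  have key : ∀ m ≤ l, (u m - x m) * g m + ∑ j ∈ Finset.range m, (x (j + 1) - x j) * g j ≤
      ∑ j ∈ Finset.range m, (u (j + 1) - u j) * g j + (u 0 - x 0) * g 0 := by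
    intro m
    induction m with
    | zero => simp
    | succ m ih =>
      intro hm
      have h1 := ih (by omega)
      have h2 := mul_le_mul_of_nonneg_left (hg (Nat.le_succ m)) (sub_nonneg.2 (hxu (m + 1) hm))
      rw [Finset.sum_range_succ, Finset.sum_range_succ]
      simp only [Nat.succ_eq_add_one] at h2
      nlinarith
  have h := key l le_rfl
  have h3 := mul_nonneg hx0 hg0
  rw [hl] at h
  linarith

lemma fib_succ_le_goldenRatio_pow (n : ℕ) : (Nat.fib (n + 1) : ℝ) ≤ Real.goldenRatio ^ n := by
  induction n using Nat.strong_induction_on with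
  | _ n ih =>
    match n with
    | 0 => simp
    | 1 => simpa using Real.one_lt_goldenRatio.le
    | n + 2 =>
      have h1 := ih n (by omega)
      have h2 := ih (n + 1) (by omega)
      rw [show n + 2 + 1 = (n + 1) + 2 by ring, Nat.fib_add_two, pow_add, Real.goldenRatio_sq]
      push_cast
      rw [pow_succ] at h2
      linarith

lemma log_goldenRatio_le : Real.log Real.goldenRatio ≤ 7 / 10 * Real.log 2 := by
  have h5 : √5 ≤ 2.2362 := by
    rw [Real.sqrt_le_left (by norm_num)]; norm_num
  -- φ^10 ≈ 122.99 lies just below 2^7 = 128.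
  have h : Real.goldenRatio ^ 10 ≤ 2 ^ 7 := by
    calc Real.goldenRatio ^ 10 ≤ 1.6181 ^ 10 := by
          refine pow_le_pow_left₀ Real.goldenRatio_pos.le ?_ 10
          rw [Real.goldenRatio]; linarith
      _ ≤ 2 ^ 7 := by norm_num
  have := Real.log_le_log (pow_pos Real.goldenRatio_pos 10) h
  rw [Real.log_pow, Real.log_pow] at this
  push_cast at this
  linarith

lemma log_two_mul_fib_le (j : ℕ) :
    Real.log (2 * Nat.fib (j + 1)) ≤ Real.log 2 * (1 + 7 / 10 * j) := by
  have hF : (0 : ℝ) < Nat.fib (j + 1) := by exact_mod_cast Nat.fib_pos.2 (Nat.succ_pos j)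
  have h := Real.log_le_log hF (fib_succ_le_goldenRatio_pow j)
  rw [Real.log_pow] at h
  rw [Real.log_mul two_ne_zero hF.ne']
  have := mul_le_mul_of_nonneg_left log_goldenRatio_le (Nat.cast_nonneg (α := ℝ) j)
  linarith

/-- With a = F_{k+1} and b = F_{k+2}, the addition formula gives F_{j+k+2} ≤ F_{j+1}(a + b), and b²
- a² ≤ (3/2)ab is (2b + a)(2a - b) ≥ 0, true because b ≤ 2a. The resulting bound depends only on j +
k. -/
lemma fib_weight_le (j k : ℕ) :
    (1 / (Nat.fib (k + 1) : ℝ) - 1 / Nat.fib (k + 2)) / Nat.fib (j + 1) ≤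
      3 / 2 / Nat.fib (j + k + 2) := by
  have ha : (0 : ℝ) < Nat.fib (k + 1) := by exact_mod_cast Nat.fib_pos.2 (Nat.succ_pos k)
  have hb : (0 : ℝ) < Nat.fib (k + 2) := by exact_mod_cast Nat.fib_pos.2 (Nat.succ_pos _)
  have hc : (0 : ℝ) < Nat.fib (j + 1) := by exact_mod_cast Nat.fib_pos.2 (Nat.succ_pos _)
  have hd : (0 : ℝ) < Nat.fib (j + k + 2) := by exact_mod_cast Nat.fib_pos.2 (Nat.succ_pos _)
  have h1 : (Nat.fib (k + 2) : ℝ) ≤ 2 * Nat.fib (k + 1) := by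
    have := Nat.fib_le_fib_succ (n := k)
    have h2 := Nat.fib_add_two (n := k)
    exact_mod_cast (by omega : Nat.fib (k + 2) ≤ 2 * Nat.fib (k + 1))
  have h2 : (Nat.fib (j + k + 2) : ℝ) ≤
      Nat.fib (j + 1) * (Nat.fib (k + 1) + Nat.fib (k + 2)) := by
    have h := Nat.fib_add j (k + 1)
    have h3 := Nat.fib_le_fib_succ (n := j)
    rw [show j + (k + 1) + 1 = j + k + 2 by ring] at h
    rw [h]
    push_cast
    have h4 : (Nat.fib j : ℝ) ≤ Nat.fib (j + 1) := by exact_mod_cast h3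
    nlinarith
  rw [div_sub_div _ _ ha.ne' hb.ne', div_div, div_le_div_iff₀ (by positivity) hd]
  set a : ℝ := (Nat.fib (k + 1) : ℝ)
  set b : ℝ := (Nat.fib (k + 2) : ℝ)
  set c : ℝ := (Nat.fib (j + 1) : ℝ)
  have hab : a ≤ b := Nat.cast_le.2 (Nat.fib_le_fib_succ (n := k + 1))
  calc (1 * b - a * 1) * (Nat.fib (j + k + 2) : ℝ) ≤ (1 * b - a * 1) * (c * (a + b)) := by
        apply mul_le_mul_of_nonneg_left h2; linarith
    _ ≤ 3 / 2 * (a * b * c) := by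
        have : 0 ≤ (2 * b + a) * (2 * a - b) := mul_nonneg (by linarith) (by linarith)
        nlinarith [mul_nonneg hc.le this]

/-- This is the square of 2^{(l-3)/2}(21l + 43) ≤ 40 F_{l+1}, with 12800 = 8 · 40². In the induction
F_{l+2}/F_{l+1} ≥ 8/5, and (8/5)² absorbs both the factor 2 and the growth of (21l + 43)². -/
lemma two_pow_mul_sq_le_fib_sq {l : ℕ} (hl : 10 ≤ l) :
    2 ^ l * (21 * l + 43) ^ 2 ≤ 12800 * Nat.fib (l + 1) ^ 2 := by
  induction l, hl using Nat.le_induction with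
  | base => decide
  | succ l hl ih =>
    obtain ⟨k, rfl⟩ : ∃ k, l = k + 4 := ⟨l - 4, by omega⟩
    have h : 8 * Nat.fib (k + 5) ≤ 5 * Nat.fib (k + 6) := by
      have h1 := Nat.fib_add_two (n := k)
      have h2 := Nat.fib_add_two (n := k + 1)
      have h3 := Nat.fib_add_two (n := k + 2)
      have h5 := Nat.fib_add_two (n := k + 3)
      have h6 := Nat.fib_add_two (n := k + 4)
      have h4 := Nat.fib_le_fib_succ (n := k)
      simp only [Nat.add_assoc, Nat.reduceAdd] at h1 h2 h3 h4 h5 h6 ⊢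
      omega
    have h2 : 25 * (2 * (21 * (k + 4 + 1) + 43) ^ 2) ≤ 64 * (21 * (k + 4) + 43) ^ 2 := by
      nlinarith
    have h3 : 64 * Nat.fib (k + 5) ^ 2 ≤ 25 * Nat.fib (k + 6) ^ 2 := by
      have := Nat.pow_le_pow_left h 2
      rw [mul_pow, mul_pow] at this
      exact this
    have h4 := Nat.mul_le_mul_left (2 ^ (k + 4)) h2
    rw [pow_succ]
    change 2 ^ (k + 4) * 2 * _ ≤ 12800 * Nat.fib (k + 6) ^ 2
    change 2 ^ (k + 4) * (21 * (k + 4) + 43) ^ 2 ≤ 12800 * Nat.fib (k + 5) ^ 2 at ih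
    nlinarith

lemma two_rpow_half_sq_mul_eight (l : ℕ) :
    ((2 : ℝ) ^ (((l : ℝ) - 3) / 2)) ^ 2 * 8 = 2 ^ l := by
  rw [← Real.rpow_natCast, ← Real.rpow_mul two_pos.le,
    show (((l : ℝ) - 3) / 2) * ((2 : ℕ) : ℝ) = l - 3 by push_cast; ring,
    Real.rpow_sub two_pos, Real.rpow_natCast]
  norm_num

lemma sum_den_le {q : ℕ → ℕ} (hq0 : q 0 = 1) (hmono : Monotone q)
    (hfib : ∀ l, q l + q (l + 1) ≤ q (l + 2)) {l : ℕ} (hl : 10 ≤ l) :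
    ∑ j ∈ Finset.range l, ((q (j + 1) : ℝ) - q j) * (Real.log (2 * q j) / q j) ≤
      q l * (Real.log 2 * ((l : ℝ) / (2 : ℝ) ^ (((l : ℝ) - 3) / 2))) := by
  set g : ℕ → ℝ := fun j => Real.log (2 * q j) / q j with hg
  have hlog2 : 0 < Real.log 2 := Real.log_pos one_lt_two
  have hganti : Antitone g := fun i j hij =>
    log_two_mul_div_antitone (one_le_den hq0 hmono i) (hmono hij)
  have hg0 : g 0 = Real.log 2 := by simp [hg, hq0]
  have hql : (0 : ℝ) < q l := by exact_mod_cast one_le_den hq0 hmono l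
  have hF : ∀ n, (0 : ℝ) < Nat.fib (n + 1) := fun n => by
    exact_mod_cast Nat.fib_pos.2 (Nat.succ_pos n)
  have hgle : ∀ j, g j ≤ Real.log 2 * (1 + 7 / 10 * j) / Nat.fib (j + 1) := fun j =>
    (log_two_mul_div_antitone (Nat.fib_pos.2 (Nat.succ_pos j))
      (fib_le_den hq0 hmono hfib j)).trans
        (div_le_div_of_nonneg_right (log_two_mul_fib_le j) (hF j).le)
  -- Divided by q_l, the denominators satisfy q_j/q_l ≤ 1/F_{l-j+1}, with equality at j = l.
  have habel := sum_sub_mul_le (g := g) (x := fun j => (q j : ℝ) / q l)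
    (u := fun j => 1 / (Nat.fib (l - j + 1) : ℝ)) (l := l) hganti (hg0 ▸ hlog2.le)
    (by positivity) (fun j hj => by
      have := fib_mul_den_le hmono hfib j (l - j)
      rw [Nat.add_sub_cancel' hj] at this
      rw [div_le_div_iff₀ hql (hF _), one_mul, mul_comm]
      exact_mod_cast this) (by simp [hql.ne'])
  have hterm : ∀ j ∈ Finset.range l,
      (1 / (Nat.fib (l - (j + 1) + 1) : ℝ) - 1 / Nat.fib (l - j + 1)) * g j ≤
        3 / 2 / Nat.fib (l + 1) * (Real.log 2 * (1 + 7 / 10 * j)) := by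
    intro j hj
    have hj := Finset.mem_range.1 hj
    obtain ⟨k, rfl⟩ : ∃ k, l = j + k + 1 := ⟨l - j - 1, by omega⟩
    rw [show j + k + 1 - (j + 1) + 1 = k + 1 by omega, show j + k + 1 - j + 1 = k + 2 by omega]
    have h1 : 0 ≤ 1 / (Nat.fib (k + 1) : ℝ) - 1 / Nat.fib (k + 2) := by
      rw [sub_nonneg]
      exact one_div_le_one_div_of_le (hF k) (by exact_mod_cast Nat.fib_le_fib_succ)
    calc _ ≤ (1 / (Nat.fib (k + 1) : ℝ) - 1 / Nat.fib (k + 2)) *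
          (Real.log 2 * (1 + 7 / 10 * j) / Nat.fib (j + 1)) :=
          mul_le_mul_of_nonneg_left (hgle j) h1
      _ = (1 / (Nat.fib (k + 1) : ℝ) - 1 / Nat.fib (k + 2)) / Nat.fib (j + 1) *
          (Real.log 2 * (1 + 7 / 10 * j)) := by ring
      _ ≤ _ := mul_le_mul_of_nonneg_right (fib_weight_le j k) (by positivity)
  have hsum : ∑ j ∈ Finset.range l, 3 / 2 / (Nat.fib (l + 1) : ℝ) *
      (Real.log 2 * (1 + 7 / 10 * j)) =
      3 / 2 / (Nat.fib (l + 1) : ℝ) * (Real.log 2 * (l + 7 / 20 * (l * (l - 1)))) := by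
    rw [← Finset.mul_sum, ← Finset.mul_sum]
    congr 2
    clear * -
    induction l with
    | zero => simp
    | succ l ih => rw [Finset.sum_range_succ, ih]; push_cast; ring
  have hlhs : ∑ j ∈ Finset.range l, ((q (j + 1) : ℝ) - q j) * g j =
      q l * ∑ j ∈ Finset.range l, ((q (j + 1) : ℝ) / q l - q j / q l) * g j := by
    rw [Finset.mul_sum]
    refine Finset.sum_congr rfl fun j _ => ?_
    field_simp
  change ∑ j ∈ Finset.range l, ((q (j + 1) : ℝ) - q j) * g j ≤ _
  rw [hlhs]
  refine mul_le_mul_of_nonneg_left ?_ hql.le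
  refine habel.trans ((add_le_add_left (Finset.sum_le_sum hterm) _).trans ?_)
  rw [hsum, hg0, Nat.sub_zero]
  set R : ℝ := (2 : ℝ) ^ (((l : ℝ) - 3) / 2) with hR
  have hR0 : 0 < R := by positivity
  have hR2 : R ^ 2 * 8 = 2 ^ l := two_rpow_half_sq_mul_eight l
  have hl10 : (10 : ℝ) ≤ l := by exact_mod_cast hl
  have hpow : (2 : ℝ) ^ l * (21 * l + 43) ^ 2 ≤ 12800 * (Nat.fib (l + 1) : ℝ) ^ 2 := by
    exact_mod_cast two_pow_mul_sq_le_fib_sq hl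
  have hRF : R * (21 * l + 43) ≤ 40 * Nat.fib (l + 1) := by
    refine (pow_le_pow_iff_left₀ (by positivity) (by positivity) two_ne_zero).1 ?_
    rw [mul_pow, mul_pow]
    rw [← hR2] at hpow
    linarith
  have hF0 := hF l
  have e : 3 / 2 / (Nat.fib (l + 1) : ℝ) * (Real.log 2 * (l + 7 / 20 * (l * (l - 1)))) +
      1 / (Nat.fib (l + 1) : ℝ) * Real.log 2 =
      Real.log 2 * ((3 / 2 * (l + 7 / 20 * (l * (l - 1))) + 1) / Nat.fib (l + 1)) := by
    field_simp
  rw [e]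
  refine mul_le_mul_of_nonneg_left ?_ hlog2.le
  rw [div_le_div_iff₀ hF0 hR0]
  -- The left side is (21l² + 39l + 40)/40; the constant 40 is at most 4l exactly when l ≥ 10.
  have h1 : (3 / 2 * ((l : ℝ) + 7 / 20 * (l * (l - 1))) + 1) ≤ l * (21 * l + 43) / 40 := by
    nlinarith
  calc _ ≤ l * (21 * l + 43) / 40 * R := mul_le_mul_of_nonneg_right h1 hR0.le
    _ = l * (R * (21 * l + 43)) / 40 := by ring
    _ ≤ l * (40 * Nat.fib (l + 1)) / 40 := by gcongr
    _ = _ := by ring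

/-! ### Bounds for the mean and its limsup -/

lemma kroneckerLogMean_eq_log_prod {α : ℝ} (hα : Irrational α) (N : ℕ) :
    0 < ∏ i ∈ Finset.range N, chord ((i + 1) * α) ∧
    kroneckerLogMean α N = (1 / (N : ℝ)) * Real.log (∏ i ∈ Finset.range N, chord ((i + 1) * α)) := by
  have hne : ∀ i : ℕ, chord ((i + 1) * α) ≠ 0 := by
    intro i h
    rw [chord, abs_eq_zero, mul_eq_zero, or_iff_right two_ne_zero, Real.sin_eq_zero_iff] at h
    obtain ⟨n, hn⟩ := h
    have h1 : (n : ℝ) = ((i + 1 : ℕ) : ℝ) * α := by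
      apply mul_left_cancel₀ Real.pi_ne_zero
      push_cast
      linarith
    have h2 : Irrational (((i + 1 : ℕ) : ℝ) * α) := hα.natCast_mul i.succ_ne_zero
    exact h2.ne_int n h1.symm
  refine ⟨Finset.prod_pos fun i _ => lt_of_le_of_ne (chord_nonneg _) (hne i).symm, ?_⟩
  rw [kroneckerLogMean, Real.log_prod fun i _ => hne i, ← Finset.Ico_add_one_right_eq_Icc,
    Finset.sum_Ico_eq_sum_range, Nat.add_sub_cancel]
  congr 1
  refine Finset.sum_congr rfl fun i _ => ?_
  rw [chord]
  congr 4
  push_cast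
  ring

lemma kroneckerLogMean_le_log_two {α : ℝ} (hα : Irrational α) {N : ℕ} (hN : 0 < N) :
    kroneckerLogMean α N ≤ Real.log 2 := by
  obtain ⟨hpos, heq⟩ := kroneckerLogMean_eq_log_prod hα N
  have h : ∏ i ∈ Finset.range N, chord ((i + 1) * α) ≤ 2 ^ N := by
    refine (Finset.prod_le_prod (fun i _ => chord_nonneg _) fun i _ => chord_le_two _).trans ?_
    simp
  have h1 := Real.log_le_log hpos h
  rw [Real.log_pow] at h1
  have hN' : (0 : ℝ) < N := by exact_mod_cast hN
  rw [heq, one_div, inv_mul_le_iff₀ hN']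
  exact h1

lemma one_le_div_two_rpow {l : ℕ} (hl : 1 ≤ l) (hl9 : l < 10) :
    1 ≤ (l : ℝ) / (2 : ℝ) ^ (((l : ℝ) - 3) / 2) := by
  set R : ℝ := (2 : ℝ) ^ (((l : ℝ) - 3) / 2) with hR
  have hR0 : 0 < R := by positivity
  have hR2 : R ^ 2 * 8 = 2 ^ l := two_rpow_half_sq_mul_eight l
  rw [le_div_iff₀ hR0, one_mul]
  refine (pow_le_pow_iff_left₀ hR0.le (Nat.cast_nonneg l) two_ne_zero).1 ?_
  -- The inequality fails from l = 10 on, where the Fibonacci estimate takes over.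
  have h : 2 ^ l ≤ 8 * l ^ 2 := by interval_cases l <;> norm_num
  have h' : (2 : ℝ) ^ l ≤ 8 * (l : ℝ) ^ 2 := by exact_mod_cast h
  linarith

lemma kroneckerLogMean_le_kroneckerBound {α : ℝ} (hα : Irrational α) {q : ℕ → ℕ} {p : ℕ → ℤ}
    (hq : ∀ l, bestDen α l = q l) (hq0 : q 0 = 1) (hmono : Monotone q)
    (hfib : ∀ l, q l + q (l + 1) ≤ q (l + 2))
    (hp : ∀ l, IsCoprime (p l) (q l) ∧ (q l : ℝ) * |q l * α - p l| ≤ 1) {l N : ℕ}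
    (hlN : q l ≤ N) : kroneckerLogMean α N ≤ kroneckerBound α l := by
  have hql1 := one_le_den hq0 hmono l
  have hql : (1 : ℝ) ≤ q l := by exact_mod_cast hql1
  have hN : 0 < N := by omega
  have hN' : (0 : ℝ) < N := by exact_mod_cast hN
  have hlNr : (q l : ℝ) ≤ N := by exact_mod_cast hlN
  have hlog2 : 0 < Real.log 2 := Real.log_pos one_lt_two
  have hlogq : 0 ≤ Real.log (q l) / q l := div_nonneg (Real.log_nonneg hql) (by linarith)
  have hphi : 0 < Real.log ((1 + √5) / 2) := Real.log_pos Real.one_lt_goldenRatio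
  have hratio : 0 ≤ Real.log (q l) / Real.log ((1 + √5) / 2) :=
    div_nonneg (Real.log_nonneg hql) hphi.le
  have hthird : Real.log (q l) / q l ≤
      3 * (Real.log (q l) / q l) * (Real.log (q l) / Real.log ((1 + √5) / 2) + 1) := by
    nlinarith [mul_nonneg hlogq hratio]
  rw [kroneckerBound, hq]
  rcases lt_or_ge l 10 with hl | hl
  · refine (kroneckerLogMean_le_log_two hα hN).trans ?_
    have : 1 ≤ 1 / (q l : ℝ) + (l : ℝ) / (2 : ℝ) ^ (((l : ℝ) - 3) / 2) := by
      rcases Nat.eq_zero_or_pos l with rfl | hl0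
      · simp [hq0]
      · have h1 := one_le_div_two_rpow hl0 hl
        have h2 : 0 ≤ 1 / (q l : ℝ) := by positivity
        linarith
    nlinarith
  · obtain ⟨hpos, heq⟩ := kroneckerLogMean_eq_log_prod hα N
    have h1 := prod_chord_le_exp hq0 hmono hfib p hp hlN
    rw [← Real.log_le_iff_le_exp hpos] at h1
    have h2 := sum_den_le hq0 hmono hfib hl
    have h3 : Real.log (2 * q l) / q l = Real.log 2 * (1 / q l) + Real.log (q l) / q l := by
      rw [Real.log_mul two_ne_zero (by linarith)]; ring
    rw [heq, one_div, inv_mul_le_iff₀ hN']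
    have h4 : (q l : ℝ) * (Real.log 2 * ((l : ℝ) / (2 : ℝ) ^ (((l : ℝ) - 3) / 2))) ≤
        N * (Real.log 2 * ((l : ℝ) / (2 : ℝ) ^ (((l : ℝ) - 3) / 2))) :=
      mul_le_mul_of_nonneg_right hlNr (by positivity)
    have h5 := mul_le_mul_of_nonneg_left hthird hN'.le
    rw [h3] at h1
    linarith

lemma tendsto_log_pow_div_den {q : ℕ → ℕ} (hq : Filter.Tendsto q Filter.atTop Filter.atTop)
    (k : ℕ) :
    Filter.Tendsto (fun l => Real.log (q l) ^ k / (q l : ℝ)) Filter.atTop (nhds 0) :=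
  (Real.isLittleO_pow_log_id_atTop (n := k)).tendsto_div_nhds_zero.comp
    (tendsto_natCast_atTop_atTop.comp hq)

lemma tendsto_kroneckerBound {α : ℝ} {q : ℕ → ℕ} (hq : ∀ l, bestDen α l = q l)
    (hqtop : Filter.Tendsto q Filter.atTop Filter.atTop) :
    Filter.Tendsto (fun l : ℕ => kroneckerBound α l) Filter.atTop (nhds 0) := by
  have h0 := tendsto_log_pow_div_den hqtop 0
  have h1 := tendsto_log_pow_div_den hqtop 1
  have h2 := tendsto_log_pow_div_den hqtop 2
  have h3 : Filter.Tendsto (fun l : ℕ => (l : ℝ) / (2 : ℝ) ^ (((l : ℝ) - 3) / 2))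
      Filter.atTop (nhds 0) := by
    have h := (tendsto_pow_const_div_const_pow_of_one_lt 1
      (Real.one_lt_rpow one_lt_two (by norm_num : (0 : ℝ) < 1 / 2))).mul_const ((2 : ℝ) ^ (3 / 2 : ℝ))
    rw [zero_mul] at h
    refine h.congr fun l => ?_
    rw [sub_div, Real.rpow_sub two_pos, ← Real.rpow_natCast, ← Real.rpow_natCast,
      ← Real.rpow_mul two_pos.le]
    rw [show (1 / 2 : ℝ) * l = l / 2 by ring, Nat.cast_one, Real.rpow_one, div_div_eq_mul_div,
      div_mul_eq_mul_div]
  have h := ((h0.add h3).const_mul (Real.log 2)).add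
    (((h2.const_mul (3 / Real.log ((1 + √5) / 2)))).add (h1.const_mul 3))
  simp only [add_zero, mul_zero] at h
  refine h.congr fun l => ?_
  rw [kroneckerBound, hq]
  ring

/-- The product is at least 2/q ≥ 1/q, and dividing -log q by q - 1 ≥ q/2 costs at most a factor 2.
-/
lemma neg_two_mul_log_div_le_kroneckerLogMean {α : ℝ} (hα : Irrational α) {q : ℕ} (hq : 2 ≤ q)
    {p : ℤ} (hcop : IsCoprime p q) (hp : (q : ℝ) * |q * α - p| ≤ 1) :
    -(2 * (Real.log q / q)) ≤ kroneckerLogMean α (q - 1) := by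
  obtain ⟨hpos, heq⟩ := kroneckerLogMean_eq_log_prod hα (q - 1)
  have hqr : (2 : ℝ) ≤ q := by exact_mod_cast hq
  have h := Real.log_le_log (by positivity) (le_prod_chord hq hcop hp)
  rw [Real.log_div two_ne_zero (by linarith)] at h
  have hlog2 : 0 < Real.log 2 := Real.log_pos one_lt_two
  have hlogq : 0 ≤ Real.log q := Real.log_nonneg (by linarith)
  rw [heq, Nat.cast_sub (by omega), Nat.cast_one, one_div, le_inv_mul_iff₀ (by linarith)]
  refine le_trans ?_ (le_trans (by linarith : -Real.log q ≤ Real.log 2 - Real.log q) h)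
  rw [mul_neg, neg_le_neg_iff, mul_div_assoc', mul_div_assoc', le_div_iff₀ (by linarith)]
  nlinarith

lemma limsup_kroneckerLogMean {α : ℝ} (hα : Irrational α) {q : ℕ → ℕ} {p : ℕ → ℤ}
    (hq : ∀ l, bestDen α l = q l) (hq0 : q 0 = 1) (hmono : Monotone q)
    (hfib : ∀ l, q l + q (l + 1) ≤ q (l + 2))
    (hp : ∀ l, IsCoprime (p l) (q l) ∧ (q l : ℝ) * |q l * α - p l| ≤ 1)
    (hqtop : Filter.Tendsto q Filter.atTop Filter.atTop) :
    Filter.limsup (fun N : ℕ => ((kroneckerLogMean α N : ℝ) : EReal)) Filter.atTop = 0 := by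
  apply le_antisymm
  · refine le_of_forall_gt_imp_ge_of_dense fun a ha => ?_
    obtain ⟨ε, hε0, hεa⟩ := EReal.lt_iff_exists_real_btwn.1 ha
    have hε : 0 < ε := by exact_mod_cast hε0
    refine Filter.limsup_le_of_le (by isBoundedDefault) ?_
    obtain ⟨l, hl⟩ := ((tendsto_kroneckerBound hq hqtop).eventually_lt_const hε).exists
    filter_upwards [Filter.eventually_ge_atTop (q l)] with N hN
    refine le_trans ?_ hεa.le
    exact_mod_cast (kroneckerLogMean_le_kroneckerBound hα hq hq0 hmono hfib hp hN).trans hl.le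
  · refine le_of_forall_lt_imp_le_of_dense fun a ha => ?_
    obtain ⟨ε, hεa, hε0⟩ := EReal.lt_iff_exists_real_btwn.1 ha
    have hε : ε < 0 := by exact_mod_cast hε0
    refine Filter.le_limsup_of_frequently_le' ?_
    have hlim : Filter.Tendsto (fun l => -(2 * (Real.log (q l) / q l))) Filter.atTop (nhds 0) := by
      have := ((tendsto_log_pow_div_den hqtop 1).const_mul 2).neg
      simpa using this
    have hN : Filter.Tendsto (fun l => q l - 1) Filter.atTop Filter.atTop :=
      (Filter.tendsto_sub_atTop_nat 1).comp hqtop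
    refine hN.frequently (Filter.Eventually.frequently ?_)
    filter_upwards [hlim.eventually_const_lt hε, hqtop.eventually_ge_atTop 2] with l hl hl2
    refine hεa.le.trans ?_
    exact_mod_cast hl.le.trans (neg_two_mul_log_div_le_kroneckerLogMean hα hl2 (hp l).1 (hp l).2)

/-! ### The integral of log(2 sin πx) -/

lemma log_two_mul_sin_eqOn : Set.EqOn
    (fun x : ℝ => Real.log 2 + Real.log (Real.sin (Real.pi * x)))
    (fun x : ℝ => Real.log (2 * Real.sin (Real.pi * x))) (Set.uIoo 0 1) := by
  intro x hx
  rw [Set.uIoo_of_le zero_le_one] at hx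
  have hp := Real.pi_pos
  have : 0 < Real.sin (Real.pi * x) :=
    Real.sin_pos_of_pos_of_lt_pi (mul_pos hp hx.1) (by nlinarith [hx.2])
  exact (Real.log_mul two_ne_zero this.ne').symm

lemma intervalIntegrable_log_sin_pi_mul :
    IntervalIntegrable (fun x : ℝ => Real.log (Real.sin (Real.pi * x)))
      MeasureTheory.volume 0 1 := by
  have := (intervalIntegrable_log_sin (a := 0) (b := Real.pi)).comp_mul_left (c := Real.pi)
  rw [zero_div, div_self Real.pi_ne_zero] at this
  exact this

lemma intervalIntegrable_log_two_mul_sin :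
    IntervalIntegrable (fun x : ℝ => Real.log (2 * Real.sin (Real.pi * x)))
      MeasureTheory.volume 0 1 :=
  (intervalIntegrable_const.add intervalIntegrable_log_sin_pi_mul).congr_uIoo log_two_mul_sin_eqOn

lemma integral_log_two_mul_sin :
    ∫ x in (0 : ℝ)..1, Real.log (2 * Real.sin (Real.pi * x)) = 0 := by
  rw [← intervalIntegral.integral_congr_uIoo log_two_mul_sin_eqOn,
    intervalIntegral.integral_add intervalIntegrable_const intervalIntegrable_log_sin_pi_mul,
    intervalIntegral.integral_comp_mul_left (fun y => Real.log (Real.sin y)) Real.pi_ne_zero,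
    mul_zero, mul_one, integral_log_sin_zero_pi, intervalIntegral.integral_const]
  have := Real.pi_ne_zero
  simp only [sub_zero, smul_eq_mul]
  field_simp
  ring

theorem corollary1 (α : ℝ) (hα : Irrational α) :
    (∀ l N : ℕ, bestDen α l ≤ (N : ℝ) → (N : ℝ) < bestDen α (l + 1) →
      kroneckerLogMean α N ≤ kroneckerBound α l) ∧
    Filter.Tendsto (fun l : ℕ => kroneckerBound α l) Filter.atTop (nhds 0) ∧
    Filter.limsup (fun N : ℕ => ((kroneckerLogMean α N : ℝ) : EReal)) Filter.atTop = 0 ∧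
    IntervalIntegrable (fun x : ℝ => Real.log (2 * Real.sin (Real.pi * x)))
      MeasureTheory.volume 0 1 ∧
    ∫ x in (0 : ℝ)..1, Real.log (2 * Real.sin (Real.pi * x)) = 0 := by
  obtain ⟨q, p, hq, hq0, hmono, hfib, hp⟩ := exists_convergents hα
  have hqtop : Filter.Tendsto q Filter.atTop Filter.atTop :=
    Filter.tendsto_atTop_atTop_of_monotone hmono fun b =>
      ⟨b + 1, (lt_den hq0 hmono hfib b).le⟩
  refine ⟨fun l N hlN _ => ?_, tendsto_kroneckerBound hq hqtop,
    limsup_kroneckerLogMean hα hq hq0 hmono hfib hp hqtop, intervalIntegrable_log_two_mul_sin,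
    integral_log_two_mul_sin⟩
  rw [hq] at hlN
  exact kroneckerLogMean_le_kroneckerBound hα hq hq0 hmono hfib hp (by exact_mod_cast hlN)
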